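/- Let $N\ge 2$. For $M,\gamma>0$, write $\Omega\in Lip(M,\gamma)$ if $\Omega\subset\mathbb{R}^N$ is an open set (not necessarily connected) such that for every $x\in\partial\Omega$ there are an orthonormal coordinate system $z=(\hat z,z_N)$, with $\hat z=(z_1,\dots,z_{N-1})$, and a function $\varphi_x:U_{\hat x}\to\mathbb{R}$ that is Lipschitz with constant at most $M$ for the Euclidean norm, such that for all $y\in O_x$, $$y\in\Omega\iff y_N>\varphi_x(\hat y),$$ where $$U_{\hat x}=\{\hat z\in\mathbb{R}^{N-1}:\ |z_i-x_i|<\gamma,\ i=1,\dots,N-1\},$$ $$O_x=\{z\in\mathbb{R}^N:\ |z_i-x_i|<\gamma,\ i=1,\dots,N-1,\ |z_N-x_N|<M\gamma\sqrt{N-1}\}.$$ For $\delta>0$ put $\Omega^\delta=\{x\in\Omega:\ d(x,\partial\Omega)>\delta\}$. **Proposition.** For all $R,M,\gamma>0$ there exists $\delta_0>0$, depending only on $R$, $M$, $\gamma$ (and the dimension $N$), such that for every $\Omega\in Lip(M,\gamma)$ with $\Omega\subset B(0,R)$ and every $\delta\in(0,\delta_0)$, the set $\Omega^\delta$ is homotopy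 equivalent to $\Omega$. In particular, if $\Omega$ is connected, then $\Omega^\delta$ is connected for every $\delta\in(0,\delta_0)$. -/

import Mathlib

/-- The points of `Ω` at distance larger than `ε` from the boundary of `Ω`. -/
def innerSet {n : ℕ} (Ω : Set (EuclideanSpace ℝ (Fin (n + 1)))) (ε : ℝ) :
    Set (EuclideanSpace ℝ (Fin (n + 1))) :=
  {x | x ∈ Ω ∧ ε < Metric.infDist x (frontier Ω)}

/-- The first `N - 1 = n` coordinates of `z` in the orthonormal coordinate system `b`. -/
noncomputable def hatCoord {n : ℕ}
    (b : OrthonormalBasis (Fin (n + 1)) ℝ (EuclideanSpace ℝ (Fin (n + 1))))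
    (z : EuclideanSpace ℝ (Fin (n + 1))) : EuclideanSpace ℝ (Fin n) :=
  WithLp.toLp 2 (fun i : Fin n => b.repr z i.castSucc)

/-- The last coordinate of `z` in the orthonormal coordinate system `b`. -/
noncomputable def lastCoord {n : ℕ}
    (b : OrthonormalBasis (Fin (n + 1)) ℝ (EuclideanSpace ℝ (Fin (n + 1))))
    (z : EuclideanSpace ℝ (Fin (n + 1))) : ℝ :=
  b.repr z (Fin.last n)

/-- The open cube of half-side `γ` centred at `c` in `ℝ ^ (N - 1)`. -/
def baseCube {n : ℕ} (γ : ℝ) (c : EuclideanSpace ℝ (Fin n)) : Set (EuclideanSpace ℝ (Fin n)) :=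
  {u | ∀ i, |u i - c i| < γ}

/-- The open box around `x`, in the coordinate system `b`, with base of half-side `γ` and
half-height `M γ √(N - 1)`. -/
def localBox {n : ℕ} (M γ : ℝ)
    (b : OrthonormalBasis (Fin (n + 1)) ℝ (EuclideanSpace ℝ (Fin (n + 1))))
    (x : EuclideanSpace ℝ (Fin (n + 1))) : Set (EuclideanSpace ℝ (Fin (n + 1))) :=
  {z | hatCoord b z ∈ baseCube γ (hatCoord b x) ∧
    |lastCoord b z - lastCoord b x| < M * γ * Real.sqrt n}

/-- `Ω ∈ Lip(M, γ)`: an open set (not necessarily connected) which, in a box of uniform size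
around each boundary point, is the strict epigraph of an `M`-Lipschitz function in some
orthonormal coordinate system. Only the values of `φ` on the base cube matter. -/
def IsUniformLipschitzDomain {n : ℕ} (M γ : ℝ) (Ω : Set (EuclideanSpace ℝ (Fin (n + 1)))) :
    Prop :=
  IsOpen Ω ∧
    ∀ x ∈ frontier Ω,
      ∃ (b : OrthonormalBasis (Fin (n + 1)) ℝ (EuclideanSpace ℝ (Fin (n + 1))))
        (φ : EuclideanSpace ℝ (Fin n) → ℝ),
        LipschitzOnWith M.toNNReal φ (baseCube γ (hatCoord b x)) ∧
        ∀ y ∈ localBox M γ b x, (y ∈ Ω ↔ φ (hatCoord b y) < lastCoord b y)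

open Metric Set Filter
open scoped Topology unitInterval Pointwise

/-! ### Homotopy equivalences -/

/-! Near a boundary point the last axis of the chart points inward: moving along it for a time `τ`
raises the distance to the frontier by at least `τ / (1 + M)`. Being inward is a convex condition on
the direction, so local choices glue to a continuous field `V` on `Ω`. The straight-line homotopy
along `V` never lowers the distance, hence preserves both sets, and at the final time it lands in
the inner set. -/

/-- A space homotopy equivalent to a connected space is connected. -/
theorem ContinuousMap.HomotopyEquiv.connectedSpace {X Y : Type*} [TopologicalSpace X]
    [TopologicalSpace Y] [ConnectedSpace Y] (e : ContinuousMap.HomotopyEquiv X Y) :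
    ConnectedSpace X := by
  obtain ⟨F⟩ := e.left_inv
  obtain ⟨y₀⟩ := (inferInstance : Nonempty Y)
  refine connectedSpace_iff_univ.2 ⟨⟨e.invFun y₀, trivial⟩,
    isPreconnected_of_forall (e.invFun y₀) fun x _ => ?_⟩
  have hF : Continuous fun τ : I => F (τ, x) := by fun_prop
  -- The track of `x` under the homotopy joins `x` to the connected image of `Y`.
  refine ⟨range e.invFun ∪ range fun τ : I => F (τ, x), subset_univ _, .inl ⟨y₀, rfl⟩,
    .inr ⟨1, by simp⟩, ?_⟩
  refine (isPreconnected_range e.invFun.continuous).union (e.invFun (e.toFun x)) ⟨_, rfl⟩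
    ⟨0, by simp⟩ (isPreconnected_range hF)

/-- If a deformation of `t` preserves a subset `s` and ends in `s`, then `s` is homotopy
equivalent to `t`. -/
theorem nonempty_homotopyEquiv_of_deformation {E : Type*} [TopologicalSpace E] {s t : Set E}
    (hst : s ⊆ t) (H : C(I × t, E)) (h0 : ∀ z : t, H (0, z) = z) (ht : ∀ τ z, H (τ, z) ∈ t)
    (hs : ∀ τ (z : t), (z : E) ∈ s → H (τ, z) ∈ s) (h1 : ∀ z, H (1, z) ∈ s) :
    Nonempty (ContinuousMap.HomotopyEquiv s t) := by
  let i : C(s, t) := ⟨inclusion hst, continuous_inclusion hst⟩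
  let r : C(t, s) := ⟨fun z => ⟨H (1, z), h1 z⟩, by fun_prop⟩
  let F : (ContinuousMap.id s).Homotopy (r.comp i) :=
    { toFun := fun p => ⟨H (p.1, i p.2), hs _ _ p.2.2⟩
      continuous_toFun := by fun_prop
      map_zero_left := fun z => Subtype.ext (h0 _)
      map_one_left := fun z => rfl }
  let G : (ContinuousMap.id t).Homotopy (i.comp r) :=
    { toFun := fun p => ⟨H p, ht _ _⟩
      continuous_toFun := by fun_prop
      map_zero_left := fun z => Subtype.ext (h0 _)
      map_one_left := fun z => rfl }
  exact ⟨⟨i, r, ⟨F.symm⟩, ⟨G.symm⟩⟩⟩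

/-! ### Distance to the frontier -/

theorem IsOpen.le_infDist_frontier {X : Type*} [PseudoMetricSpace X] {Ω : Set X}
    (hΩ : IsOpen Ω) (hne : (frontier Ω).Nonempty) {q : X} {ρ : ℝ}
    (h : ball q ρ ⊆ Ω) : ρ ≤ infDist q (frontier Ω) := by
  refine (le_infDist hne).2 fun z hz => ?_
  by_contra! hlt
  rw [hΩ.frontier_eq] at hz
  exact hz.2 (h (mem_ball'.2 hlt))

section InfDist

variable {E : Type*} [NormedAddCommGroup E] [NormedSpace ℝ E] {Ω : Set E}

/-- The ball is connected and misses the frontier, so it cannot leave `Ω`. -/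
theorem IsOpen.ball_infDist_frontier_subset (hΩ : IsOpen Ω) {y : E} (hy : y ∈ Ω) :
    ball y (infDist y (frontier Ω)) ⊆ Ω := by
  rcases le_or_gt (infDist y (frontier Ω)) 0 with h | h
  · simp [ball_eq_empty.2 h]
  refine (convex_ball y _).isPreconnected.subset_of_closure_inter_subset hΩ
    ⟨y, mem_ball_self h, hy⟩ ?_
  rintro z ⟨hz, hzb⟩
  by_contra hzΩ
  have hzf : z ∈ frontier Ω := by
    rw [hΩ.frontier_eq]; exact ⟨hz, hzΩ⟩
  have := infDist_le_dist_of_mem (x := y) hzf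
  rw [mem_ball'] at hzb
  linarith

/-- If the translates of the points of a maximal ball in `Ω` by `v` are centres of balls of
radius `ε` in `Ω`, then translating by `v` increases the distance to the frontier by `ε`. -/
theorem IsOpen.infDist_frontier_add_le (hΩ : IsOpen Ω) (hne : (frontier Ω).Nonempty) {y v : E}
    {ε : ℝ} (hy : y ∈ Ω) (hε : 0 < ε)
    (h : ∀ p ∈ Ω, dist p y < infDist y (frontier Ω) → ∀ u, ‖u‖ < ε → p + v + u ∈ Ω) :
    y + v ∈ Ω ∧ infDist y (frontier Ω) + ε ≤ infDist (y + v) (frontier Ω) := by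
  have hd : 0 < infDist y (frontier Ω) := by
    refine (isClosed_frontier.notMem_iff_infDist_pos hne).1 fun hyf => ?_
    rw [hΩ.frontier_eq] at hyf
    exact hyf.2 hy
  refine ⟨by simpa using h y hy (by simpa using hd) 0 (by simpa using hε),
    hΩ.le_infDist_frontier hne fun q hq => ?_⟩
  -- In a normed space the larger ball is the Minkowski sum of the balls of radii `infDist y
  -- (frontier Ω)` and `ε`.
  have hq' : q - v ∈ ball y (infDist y (frontier Ω)) + ball (0 : E) ε := by
    rw [ball_add_ball hd hε, add_zero, mem_ball_iff_norm]
    rw [mem_ball_iff_norm] at hq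
    convert hq using 2; abel
  obtain ⟨p, hp, u, hu, hpu⟩ := hq'
  have := h p (hΩ.ball_infDist_frontier_subset hy hp) hp u (by simpa using hu)
  convert this using 1
  rw [add_right_comm, show p + u = q - v from hpu, sub_add_cancel]

/-- The directions `w` of length at most one such that moving points near `z` along `w` for a
time `τ ≤ r` remains in `Ω` and increases the distance to the frontier at rate at least `c`. -/
def inwardDirections (Ω : Set E) (r c : ℝ) (z : E) : Set E :=
  {w | ‖w‖ ≤ 1 ∧ ∀ τ, 0 ≤ τ → τ ≤ r → ∀ y ∈ Ω, dist y z ≤ r - τ →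
    y + τ • w ∈ Ω ∧ infDist y (frontier Ω) + c * τ ≤ infDist (y + τ • w) (frontier Ω)}

/-- Move along `w₁` for time `τ * a`, then along `w₂` for time `τ * b`. The gains add, and the
shrinking radius `r - τ` keeps the intermediate point admissible. -/
theorem convex_inwardDirections (Ω : Set E) (r c : ℝ) (z : E) :
    Convex ℝ (inwardDirections Ω r c z) := by
  rintro w₁ ⟨hn₁, h₁⟩ w₂ ⟨hn₂, h₂⟩ a b ha hb hab
  refine ⟨?_, fun τ h0 hr y hy hyz => ?_⟩
  · simpa using convex_closedBall (0 : E) 1 (by simpa using hn₁) (by simpa using hn₂) ha hb hab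
  have haτ : 0 ≤ τ * a := by positivity
  have hbτ : 0 ≤ τ * b := by positivity
  have hsum : τ * a + τ * b = τ := by rw [← mul_add, hab, mul_one]
  obtain ⟨hm, hd⟩ := h₁ (τ * a) haτ (by linarith) y hy (by linarith)
  have hdist : dist (y + (τ * a) • w₁) z ≤ r - τ * b := by
    have h1 : dist (y + (τ * a) • w₁) y ≤ τ * a := by
      rw [dist_eq_norm, add_sub_cancel_left, norm_smul, Real.norm_of_nonneg haτ]
      exact mul_le_of_le_one_right haτ hn₁
    linarith [dist_triangle (y + (τ * a) • w₁) y z]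
  obtain ⟨hm', hd'⟩ := h₂ (τ * b) hbτ (by linarith) _ hm hdist
  have heq : y + τ • (a • w₁ + b • w₂) = y + (τ * a) • w₁ + (τ * b) • w₂ := by
    rw [smul_add, smul_smul, smul_smul, add_assoc]
  have hc : c * τ = c * (τ * a) + c * (τ * b) := by rw [← mul_add, hsum]
  rw [heq]
  exact ⟨hm', by linarith⟩

/-- If every point of `Ω` at distance at most `δ` from the frontier has a direction that is inward
for all nearby points, then a continuous choice of inward directions deforms `Ω` into its points
at distance larger than `δ` from the frontier. -/
theorem nonempty_homotopyEquiv_of_inwardDirections {r c δ : ℝ} (hr : 0 < r) (hδ : δ < c * r)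
    (h : ∀ z ∈ Ω, infDist z (frontier Ω) ≤ δ →
      ∃ w, ∀ᶠ y in 𝓝 z, w ∈ inwardDirections Ω r c y ∩ inwardDirections Ω r 0 y) :
    Nonempty (ContinuousMap.HomotopyEquiv
      ({x | x ∈ Ω ∧ δ < infDist x (frontier Ω)} : Set E) Ω) := by
  obtain ⟨V, hV⟩ := exists_continuous_forall_mem_convex_of_local_const
    (t := fun z : Ω => inwardDirections Ω r 0 z ∩
      {w | infDist (z : E) (frontier Ω) ≤ δ → w ∈ inwardDirections Ω r c z}) (fun z => by
      refine (convex_inwardDirections _ _ _ _).inter ?_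
      by_cases hz : infDist (z : E) (frontier Ω) ≤ δ
      · simpa [hz] using convex_inwardDirections Ω r c (z : E)
      · simpa [hz] using convex_univ) (fun z => by
      by_cases hz : infDist (z : E) (frontier Ω) ≤ δ
      · obtain ⟨w, hw⟩ := h z z.2 hz
        refine ⟨w, (continuous_subtype_val.continuousAt.eventually hw).mono fun y hy => ?_⟩
        exact ⟨hy.2, fun _ => hy.1⟩
      · have hc : Continuous fun y : Ω => infDist (y : E) (frontier Ω) :=
          (continuous_infDist_pt _).comp continuous_subtype_val
        -- Farther than `δ` from the frontier only rate `0` is required, so standing still is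
        -- allowed.
        refine ⟨0, (hc.continuousAt.eventually (lt_mem_nhds (not_le.1 hz))).mono fun y hy => ?_⟩
        exact ⟨⟨by simp, fun τ _ _ p hp _ => by simpa using hp⟩, fun hy' => absurd hy hy'.not_gt⟩)
  have key (τ : I) (z : Ω) : (z : E) + ((τ : ℝ) * r) • V z ∈ Ω ∧
      infDist (z : E) (frontier Ω) ≤ infDist ((z : E) + ((τ : ℝ) * r) • V z) (frontier Ω) := by
    have hτ : (τ : ℝ) * r ≤ r := mul_le_of_le_one_left hr.le τ.2.2
    simpa using (hV z).1.2 (τ * r) (mul_nonneg τ.2.1 hr.le) hτ z z.2 (by simpa using hτ)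
  refine nonempty_homotopyEquiv_of_deformation (fun x hx => hx.1)
    ⟨fun p => (p.2 : E) + ((p.1 : ℝ) * r) • V p.2, by fun_prop⟩ (by simp)
    (fun τ z => (key τ z).1) (fun τ z hz => ⟨(key τ z).1, hz.2.trans_le (key τ z).2⟩)
    (fun z => ⟨(key 1 z).1, ?_⟩)
  by_cases hz : infDist (z : E) (frontier Ω) ≤ δ
  · have := (((hV z).2 hz).2 r hr.le le_rfl z z.2 (by simp)).2
    simp only [ContinuousMap.coe_mk, Icc.coe_one, one_mul]
    linarith [infDist_nonneg (x := (z : E)) (s := frontier Ω)]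
  · exact (not_le.1 hz).trans_le (key 1 z).2

end InfDist

/-! ### Local coordinates -/

section Coordinates

variable {n : ℕ} (b : OrthonormalBasis (Fin (n + 1)) ℝ (EuclideanSpace ℝ (Fin (n + 1))))

theorem hatCoord_add (x y : EuclideanSpace ℝ (Fin (n + 1))) :
    hatCoord b (x + y) = hatCoord b x + hatCoord b y := by
  ext i; simp [hatCoord]

theorem lastCoord_add (x y : EuclideanSpace ℝ (Fin (n + 1))) :
    lastCoord b (x + y) = lastCoord b x + lastCoord b y := by
  simp [lastCoord]

theorem hatCoord_smul_last (s : ℝ) : hatCoord b (s • b (Fin.last n)) = 0 := by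
  ext i; simp [hatCoord]

theorem lastCoord_smul_last (s : ℝ) : lastCoord b (s • b (Fin.last n)) = s := by
  simp [lastCoord]

theorem norm_sq_hatCoord_add (x : EuclideanSpace ℝ (Fin (n + 1))) :
    ‖hatCoord b x‖ ^ 2 + lastCoord b x ^ 2 = ‖x‖ ^ 2 := by
  rw [← b.repr.norm_map x, EuclideanSpace.norm_sq_eq, EuclideanSpace.norm_sq_eq,
    Fin.sum_univ_castSucc]
  simp [hatCoord, lastCoord]

theorem norm_hatCoord_le (x : EuclideanSpace ℝ (Fin (n + 1))) : ‖hatCoord b x‖ ≤ ‖x‖ := by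
  refine le_of_abs_le (abs_le_of_sq_le_sq ?_ (norm_nonneg x))
  nlinarith [norm_sq_hatCoord_add b x, sq_nonneg (lastCoord b x)]

theorem abs_lastCoord_le (x : EuclideanSpace ℝ (Fin (n + 1))) : |lastCoord b x| ≤ ‖x‖ := by
  refine abs_le_of_sq_le_sq ?_ (norm_nonneg x)
  nlinarith [norm_sq_hatCoord_add b x, sq_nonneg ‖hatCoord b x‖]

theorem mem_localBox_of_dist_lt {M γ : ℝ} {x z : EuclideanSpace ℝ (Fin (n + 1))}
    (h₁ : dist z x < γ) (h₂ : dist z x < M * γ * Real.sqrt n) : z ∈ localBox M γ b x := by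
  have hz : z = x + (z - x) := by abel
  rw [dist_eq_norm] at h₁ h₂
  refine ⟨fun i => ?_, ?_⟩
  · rw [hz, hatCoord_add, PiLp.add_apply, add_sub_cancel_left]
    exact ((PiLp.norm_apply_le (hatCoord b (z - x)) i).trans (norm_hatCoord_le b _)).trans_lt h₁
  · rw [hz, lastCoord_add, add_sub_cancel_left]
    exact (abs_lastCoord_le b _).trans_lt h₂

end Coordinates

/-- Near a boundary point, the last axis of the local coordinate system is inward. -/
theorem IsUniformLipschitzDomain.exists_inwardDirection {n : ℕ} {M γ ρ : ℝ} (hM : 0 < M)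
    (hρ : 0 < ρ) (hρ₁ : 10 * ρ ≤ γ) (hρ₂ : 10 * ρ ≤ M * γ * Real.sqrt n)
    {Ω : Set (EuclideanSpace ℝ (Fin (n + 1)))} (hΩ : IsUniformLipschitzDomain M γ Ω)
    {x : EuclideanSpace ℝ (Fin (n + 1))} (hx : x ∈ frontier Ω) :
    ∃ w, ∀ z, dist z x ≤ 2 * ρ → w ∈ inwardDirections Ω ρ (1 / (1 + M)) z := by
  obtain ⟨b, φ, hφ, hbox⟩ := hΩ.2 x hx
  have hbox' {q} (hq : dist q x < 10 * ρ) : q ∈ localBox M γ b x :=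
    mem_localBox_of_dist_lt b (hq.trans_le hρ₁) (hq.trans_le hρ₂)
  have hc : 0 < 1 / (1 + M) := by positivity
  have hc1 : 1 / (1 + M) ≤ 1 := by rw [div_le_one (by positivity)]; linarith
  -- This balance fixes the rate `c`: the rise `τ` pays for a vertical loss `c * τ` and a graph
  -- variation `M * (c * τ)`.
  have hcM : 1 / (1 + M) + M * (1 / (1 + M)) = 1 := by field_simp
  generalize 1 / (1 + M) = c at hc hc1 hcM
  refine ⟨b (Fin.last n), fun z hz => ⟨by simp, fun τ h0 hτ y hy hyz => ?_⟩⟩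
  rcases h0.eq_or_lt with rfl | h0
  · simpa using hy
  refine hΩ.1.infDist_frontier_add_le ⟨x, hx⟩ hy (by positivity) fun p hp hpy u hu => ?_
  have hyx : dist y x ≤ 3 * ρ := by linarith [dist_triangle y z x]
  -- As `x` is on the frontier, `dist p y < dist y x ≤ 3 * ρ`.
  have hpx : dist p x < 6 * ρ := by
    linarith [dist_triangle p y x, infDist_le_dist_of_mem (x := y) hx]
  have huτ : ‖u‖ < τ := hu.trans_le (mul_le_of_le_one_left h0.le hc1)
  have hqp : dist (p + τ • b (Fin.last n) + u) p < 2 * ρ := by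
    rw [dist_eq_norm, add_assoc, add_sub_cancel_left]
    have := norm_add_le (τ • b (Fin.last n)) u
    rw [norm_smul, b.norm_eq_one, mul_one, Real.norm_of_nonneg h0.le] at this
    linarith
  have hpb := hbox' (q := p) (by linarith)
  have hqb := hbox' (q := p + τ • b (Fin.last n) + u)
    (by linarith [dist_triangle (p + τ • b (Fin.last n) + u) p x])
  rw [hbox _ hqb]
  have hpφ := (hbox p hpb).1 hp
  have hlip := hφ.dist_le_mul _ hqb.1 _ hpb.1
  have hhat : hatCoord b (p + τ • b (Fin.last n) + u) = hatCoord b p + hatCoord b u := by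
    rw [hatCoord_add, hatCoord_add, hatCoord_smul_last, add_zero]
  rw [hhat, dist_eq_norm (_ + _), add_sub_cancel_left, Real.dist_eq,
    Real.coe_toNNReal M hM.le] at hlip
  rw [hhat, lastCoord_add, lastCoord_add, lastCoord_smul_last]
  have h1 := (abs_le.1 (abs_lastCoord_le b u)).1
  have h2 := (abs_le.1 hlip).2
  have h3 : M * ‖hatCoord b u‖ ≤ M * (c * τ) :=
    mul_le_mul_of_nonneg_left ((norm_hatCoord_le b u).trans hu.le) hM.le
  have h4 : c * τ + M * (c * τ) = τ := by rw [← mul_assoc, ← add_mul, hcM, one_mul]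
  linarith

theorem mainTheorem6 (n : ℕ) (hn : 1 ≤ n) (R M γ : ℝ) (hR : 0 < R) (hM : 0 < M) (hγ : 0 < γ) :
    ∃ δ₀ : ℝ, 0 < δ₀ ∧
      ∀ Ω : Set (EuclideanSpace ℝ (Fin (n + 1))),
        Ω ⊆ Metric.ball 0 R → IsUniformLipschitzDomain M γ Ω →
          (∀ δ : ℝ, 0 < δ → δ < δ₀ →
            Nonempty (ContinuousMap.HomotopyEquiv (innerSet Ω δ) Ω)) ∧
          (IsConnected Ω → ∀ δ : ℝ, 0 < δ → δ < δ₀ → IsConnected (innerSet Ω δ)) := by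
  have hn' : 0 < Real.sqrt n := Real.sqrt_pos.2 (by exact_mod_cast hn)
  obtain ⟨ρ, hρ, hρ'⟩ : ∃ ρ : ℝ, 0 < ρ ∧ 10 * ρ = min γ (M * γ * Real.sqrt n) :=
    ⟨min γ (M * γ * Real.sqrt n) / 10, by positivity, by ring⟩
  have hc : 0 < 1 / (1 + M) := by positivity
  have hc1 : 1 / (1 + M) ≤ 1 := by rw [div_le_one (by positivity)]; linarith
  refine ⟨1 / (1 + M) * ρ, by positivity, fun Ω hΩR hΩ => ?_⟩
  have equiv (δ : ℝ) (hδ : δ < 1 / (1 + M) * ρ) :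
      Nonempty (ContinuousMap.HomotopyEquiv (innerSet Ω δ) Ω) := by
    refine nonempty_homotopyEquiv_of_inwardDirections hρ hδ fun z hz hzδ => ?_
    -- Boundedness only excludes an empty frontier, where `infDist` is `0` by convention.
    have hne : (frontier Ω).Nonempty := nonempty_frontier_iff.2 ⟨⟨z, hz⟩, fun h =>
      NormedSpace.unbounded_univ ℝ (EuclideanSpace ℝ (Fin (n + 1)))
        (isBounded_ball.subset (h ▸ hΩR))⟩
    obtain ⟨x, hx, hzx⟩ := isClosed_frontier.exists_infDist_eq_dist hne z
    obtain ⟨w, hw⟩ := hΩ.exists_inwardDirection hM hρ (hρ'.trans_le (min_le_left _ _))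
      (hρ'.trans_le (min_le_right _ _)) hx
    refine ⟨w, (ball_mem_nhds z hρ : _) |> Filter.mem_of_superset <| fun y hy => ?_⟩
    have hyw := hw y (by
      linarith [dist_triangle y z x, mem_ball.1 hy, mul_le_of_le_one_left hρ.le hc1])
    refine ⟨hyw, hyw.1, fun τ h0 hτ p hp hpy => ?_⟩
    obtain ⟨h1, h2⟩ := hyw.2 τ h0 hτ p hp hpy
    exact ⟨h1, by linarith [mul_nonneg hc.le h0]⟩
  refine ⟨fun δ _ hδ => equiv δ hδ, fun hconn δ _ hδ => ?_⟩
  obtain ⟨e⟩ := equiv δ hδ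
  have := isConnected_iff_connectedSpace.1 hconn
  exact isConnected_iff_connectedSpace.2 e.connectedSpace
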